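/- Let $n\ge 1$ and write $|\Phi_n\rangle = 2^{-n/2}\sum_{k\in\{0,1\}^n}|k\rangle|k\rangle$. Let $\mathcal{P}_n^*$ be the set of the $4^n-1$ non-identity $n$-fold tensor products of the Pauli matrices $I,X,Y,Z$, and let $Z_a=\bigotimes_i Z^{a_i}$ for $a\in\{0,1\}^n$. The depolarizing channel is $\mathcal{D}_p(\varphi)=p\,\varphi+\frac{1-p}{2^{2n}-1}\sum_{P\in\mathcal{P}_n^*}P\varphi P$. For a finite ensemble $\mathcal{E}=\{(p_i,U_i)\}$ of $n$-qubit unitaries $U_i$ with probabilities $p_i$, the twirl of a channel $\mathcal{C}$ is $\mathbb{E}_{\mathcal{E}}(\mathcal{C})(\rho)=\sum_i p_i\,U_i^\dagger\,\mathcal{C}(U_i\rho U_i^\dagger)\,U_i$. Let $\mathcal{M}(\rho)=\sum_{k}\operatorname{tr}\big[|k\rangle\langle k|\rho\big]\,\rho_k$ with $\rho_k=\frac{1}{2^n-1}\sum_{l\neq k}|l\rangle\langle l|$ be the measure-and-prepare channel in the computational basis. Call unitaries $V_0,\dots,V_{2^n}$ a diagonalizing family if there are a partition of $\mathcal{P}_n^*$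 into $2^n+1$ sets $S_0,\dots,S_{2^n}$, each a maximal set of pairwise commuting elements of $\mathcal{P}_n^*$ and of size $2^n-1$, and signs $s_{j,a}\in\{\pm1\}$ such that $S_j=\{s_{j,a}V_jZ_aV_j^\dagger : a\in\{0,1\}^n,\ a\ne 0\}$ for every $j$. Diagonalizing families exist. For any such family, let $\mathcal{V}$ be the uniform ensemble over the $2^n+1$ adjoints $V_j^\dagger$. **Theorem.** Let $\mathcal{C}$ be an $n$-qubit quantum channel (a completely positive trace-preserving map) with entanglement fidelity $F(\mathcal{C})=\langle\Phi_n|(\mathcal{I}\otimes\mathcal{C})(|\Phi_n\rangle\langle\Phi_n|)|\Phi_n\rangle\neq 0$, let $\mathcal{E}$ be a finite unitary ensemble with $\mathbb{E}_{\mathcal{E}}(\mathcal{C})=\mathcal{D}_{F(\mathcal{C})}$, and let $\mathcal{V}$ be as above for an arbitrary diagonalizing family. Then the $n$-qubit identity channel has the quasiprobability decomposition $$\mathcal{I}^{\otimes n}=\frac{1}{F(\mathcal{C})}\,\mathbb{E}_{\mathcal{E}}(\mathcal{C})-\left(\frac{1}{F(\mathcal{C})}-1\right)\mathbb{E}_{\mathcal{V}}(\mathcal{M}),$$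 that is, this identity of linear maps holds, $\mathbb{E}_{\mathcal{E}}(\mathcal{C})$ and $\mathbb{E}_{\mathcal{V}}(\mathcal{M})$ are quantum channels, and the real coefficients sum to $1$. Its sampling overhead, the sum of the absolute values of the coefficients, is $$\kappa=\left|\frac{1}{F(\mathcal{C})}\right|+\left|-\left(\frac{1}{F(\mathcal{C})}-1\right)\right|=\frac{2}{F(\mathcal{C})}-1 .$$ -/

import Mathlib

open scoped Matrix ComplexOrder

noncomputable section

namespace ChannelQPD

/-- Binary vectors `(k₀, …, k_{n-1})`, which label the computational basis of `n` qubits. -/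
abbrev Bits (n : ℕ) := Fin n → Fin 2

/-- Linear operators on the `n`-qubit space `(ℂ²)^{⊗ n}`, as matrices in the computational basis. -/
abbrev QOp (n : ℕ) := Matrix (Bits n) (Bits n) ℂ

/-- Linear maps on `n`-qubit operators. -/
abbrev SuperOp (n : ℕ) := QOp n →ₗ[ℂ] QOp n

/-- The projector `|k⟩⟨k|` onto a computational basis state. -/
def basisProj {n : ℕ} (k : Bits n) : QOp n := Matrix.single k k 1

/-- The map `ρ ↦ A ρ B`. -/
def sandwich {n : ℕ} (A B : QOp n) : SuperOp n :=
  LinearMap.mulLeft ℂ A ∘ₗ LinearMap.mulRight ℂ B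

/-! ### Quantum channels and entanglement fidelity -/

/-- The map `𝓘_R ⊗ Φ`, where `R` is a reference system with basis indexed by `R`:
`Φ` is applied to each block of an operator on the composite of `R` and `n` qubits. -/
def ampliation {n : ℕ} (R : Type) (Φ : SuperOp n)
    (M : Matrix (R × Bits n) (R × Bits n) ℂ) : Matrix (R × Bits n) (R × Bits n) ℂ :=
  Matrix.of fun x y => Φ (Matrix.of fun k l => M (x.1, k) (y.1, l)) x.2 y.2

/-- Complete positivity: `𝓘_R ⊗ Φ` preserves positive semidefiniteness for every
finite-dimensional reference system `R`. -/
def IsCompletelyPositive {n : ℕ} (Φ : SuperOp n) : Prop :=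
  ∀ (d : ℕ) (M : Matrix (Fin d × Bits n) (Fin d × Bits n) ℂ),
    M.PosSemidef → (ampliation (Fin d) Φ M).PosSemidef

/-- An `n`-qubit quantum channel: a completely positive trace-preserving linear map. -/
structure IsChannel {n : ℕ} (Φ : SuperOp n) : Prop where
  completelyPositive : IsCompletelyPositive Φ
  tracePreserving : ∀ ρ : QOp n, (Φ ρ).trace = ρ.trace

/-- The maximally entangled vector `|Φₙ⟩ = 2^{-n/2} ∑ₖ |k⟩|k⟩`. -/
def maxEntangled (n : ℕ) : Bits n × Bits n → ℂ :=
  fun x => if x.1 = x.2 then ((1 / Real.sqrt (2 ^ n) : ℝ) : ℂ) else 0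

/-- The entanglement fidelity `F(C) = ⟨Φₙ| (𝓘 ⊗ C)(|Φₙ⟩⟨Φₙ|) |Φₙ⟩`.  For a channel `C` this
number is real; the real part is taken to obtain a value in `ℝ`. -/
def entFidelity {n : ℕ} (C : SuperOp n) : ℝ :=
  (star (maxEntangled n) ⬝ᵥ
    (ampliation (Bits n) C (Matrix.vecMulVec (maxEntangled n) (star (maxEntangled n))) *ᵥ
      maxEntangled n)).re

/-! ### Pauli operators -/

/-- The Pauli matrix `X`. -/
def pauliX : Matrix (Fin 2) (Fin 2) ℂ := !![0, 1; 1, 0]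

/-- The Pauli matrix `Z`. -/
def pauliZ : Matrix (Fin 2) (Fin 2) ℂ := !![1, 0; 0, -1]

/-- The tensor product `M₀ ⊗ ⋯ ⊗ M_{n-1}` of single-qubit operators. -/
def tensorOp {n : ℕ} (M : Fin n → Matrix (Fin 2) (Fin 2) ℂ) : QOp n :=
  Matrix.of fun k l => ∏ i, M i (k i) (l i)

/-- `X_x = ⨂ᵢ X^{xᵢ}`. -/
def opX {n : ℕ} (x : Bits n) : QOp n := tensorOp fun i => pauliX ^ (x i : ℕ)

/-- `Z_z = ⨂ᵢ Z^{zᵢ}`. -/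
def opZ {n : ℕ} (z : Bits n) : QOp n := tensorOp fun i => pauliZ ^ (z i : ℕ)

/-- The `n`-qubit Pauli operator with label `a = (x, z)`, that is `X_x Z_z` with the phase
`∏ᵢ i^{xᵢ zᵢ}` that makes it Hermitian: since `Y = i X Z`, these are exactly the tensor products
of the matrices `I`, `X`, `Y`, `Z`. -/
def pauli {n : ℕ} (a : Bits n × Bits n) : QOp n :=
  Complex.I ^ (∑ i, (a.1 i : ℕ) * (a.2 i : ℕ)) • (opX a.1 * opZ a.2)

/-- The set of non-identity `n`-qubit Pauli operators. -/
def nonIdPaulis (n : ℕ) : Set (QOp n) := {P | ∃ a : Bits n × Bits n, a ≠ 0 ∧ P = pauli a}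

/-- The depolarizing channel
`D_p(φ) = p φ + (1 - p) / (2^{2n} - 1) ∑_{P ≠ I} P φ P`. -/
def depolarizing (n : ℕ) (p : ℝ) : SuperOp n :=
  (p : ℂ) • LinearMap.id +
    (((1 - p) / (2 ^ (2 * n) - 1) : ℝ) : ℂ) •
      ∑ a ∈ Finset.univ.erase (0 : Bits n × Bits n), sandwich (pauli a) (pauli a)

/-! ### Unitary ensembles and twirling -/

/-- A finite ensemble `{(pᵢ, Uᵢ)}` of `K` unitaries on `n` qubits. -/
structure UnitaryEnsemble (n K : ℕ) where
  prob : Fin K → ℝ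
  prob_nonneg : ∀ i, 0 ≤ prob i
  prob_sum : ∑ i, prob i = 1
  unitary : Fin K → Matrix.unitaryGroup (Bits n) ℂ

/-- The channel twirl `ρ ↦ ∑ᵢ pᵢ Uᵢ† C(Uᵢ ρ Uᵢ†) Uᵢ`. -/
def twirl {n K : ℕ} (E : UnitaryEnsemble n K) (C : SuperOp n) : SuperOp n :=
  ∑ i, (E.prob i : ℂ) •
    (sandwich ((E.unitary i : QOp n)ᴴ) (E.unitary i : QOp n) ∘ₗ C ∘ₗ
      sandwich (E.unitary i : QOp n) ((E.unitary i : QOp n)ᴴ))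

/-! ### Maximally commuting sets of Pauli operators and their diagonalizing unitaries -/

/-- `S₀, …, S_{2^n}` is a partition of the non-identity Pauli operators into `2^n + 1` sets of
`2^n - 1` pairwise commuting operators, each of them maximal. -/
structure IsMaxCommutingPartition {n : ℕ} (S : Fin (2 ^ n + 1) → Set (QOp n)) : Prop where
  disjoint : Pairwise fun i j => Disjoint (S i) (S j)
  union : ⋃ j, S j = nonIdPaulis n
  card : ∀ j, (S j).ncard = 2 ^ n - 1
  commute : ∀ j, ∀ P ∈ S j, ∀ Q ∈ S j, P * Q = Q * P
  maximal : ∀ j, ∀ Q ∈ nonIdPaulis n, (∀ P ∈ S j, P * Q = Q * P) → Q ∈ S j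

/-- `V₀, …, V_{2^n}` diagonalize the sets of a partition of the non-identity Pauli operators into
maximally commuting sets: `S_j = {s_{j,a} V_j Z_a V_j† | a ≠ 0}` with signs `s_{j,a} = ±1`. -/
def IsDiagonalizingFamily {n : ℕ} (V : Fin (2 ^ n + 1) → Matrix.unitaryGroup (Bits n) ℂ) : Prop :=
  ∃ (S : Fin (2 ^ n + 1) → Set (QOp n)) (s : Fin (2 ^ n + 1) → Bits n → ℤˣ),
    IsMaxCommutingPartition S ∧
      ∀ j, S j = {P | ∃ a : Bits n, a ≠ 0 ∧
        P = (((s j a : ℤ) : ℂ)) • ((V j : QOp n) * opZ a * (V j : QOp n)ᴴ)}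

/-- The uniform ensemble over the adjoints `V_j†`. -/
def adjointEnsemble {n : ℕ} (V : Fin (2 ^ n + 1) → Matrix.unitaryGroup (Bits n) ℂ) :
    UnitaryEnsemble n (2 ^ n + 1) where
  prob := fun _ => ((2 : ℝ) ^ n + 1)⁻¹
  prob_nonneg := fun _ => by positivity
  prob_sum := by
    have h : (2 : ℝ) ^ n + 1 ≠ 0 := by positivity
    simp [h]
  unitary := fun j => star (V j)

/-! ### The measure-and-prepare channel -/

/-- The uniform mixture `ρ_k = ∑ₗ (1 - δ_{kl}) / (2^n - 1) |l⟩⟨l|` of the computational basis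
states orthogonal to `|k⟩`. -/
def preparedState {n : ℕ} (k : Bits n) : QOp n :=
  ∑ l : Bits n, (((1 - if k = l then 1 else 0) / (2 ^ n - 1) : ℝ) : ℂ) • basisProj l

/-- The measure-and-prepare channel `M : ρ ↦ ∑ₖ tr[|k⟩⟨k| ρ] ρ_k`. -/
def measurePrepare (n : ℕ) : SuperOp n :=
  ∑ k : Bits n, (Matrix.traceLinearMap (Bits n) ℂ ℂ ∘ₗ
    LinearMap.mulLeft ℂ (basisProj k)).smulRight (preparedState k)

/-! ### Quasiprobability decompositions -/

/-- `T = ∑ᵢ cᵢ 𝓕ᵢ` is a quasiprobability decomposition of `T` into quantum channels `𝓕ᵢ` with real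
coefficients `cᵢ` that sum to one. -/
structure IsQPD {n m : ℕ} (T : SuperOp n) (c : Fin m → ℝ) (F : Fin m → SuperOp n) : Prop where
  channel : ∀ i, IsChannel (F i)
  coeff_sum : ∑ i, c i = 1
  decomposition : T = ∑ i, (c i : ℂ) • F i

/-- The sampling overhead `κ = ∑ᵢ |cᵢ|` of a quasiprobability decomposition with
coefficients `cᵢ`. -/
def samplingOverhead {m : ℕ} (c : Fin m → ℝ) : ℝ := ∑ i, |c i|

end ChannelQPD

end

open scoped Matrix ComplexOrder

noncomputable section

namespace ChannelQPD

/-! The point is that twirling `measurePrepare n` over the adjoints of a diagonalizing family gives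
exactly `D_0`, the depolarizing channel with no identity part. Since `D_F = F · id + (1 - F) · D_0`,
solving for `id` gives the decomposition.

Both sides reduce to the trace and `ρ`. Summing `P ρ P` over all Paulis gives `2^n tr(ρ) I`
(`sum_pauli_conj`), so `D_0(ρ) = (2^n tr(ρ) I - ρ) / (4^n - 1)`. On the other side, `M(ρ) = (tr(ρ) I
- diag ρ) / (2^n - 1)`, and dephasing in the basis of `V_j` is `2^{-n} (ρ + ∑_{P ∈ S_j} P ρ P)`
(`conj_diagonal_eq_sum`). Because the `S_j` partition the non-identity Paulis, averaging over `j`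
again produces the full Pauli sum (`twirl_measurePrepare`).

The overhead needs `0 < F ≤ 1`. Positivity of the Choi operator gives `0 ≤ F`; the bound `F ≤ 1`
holds because `D_F`, being a twirl of a channel, is itself a channel.

Diagonalizing families come from a symplectic spread. Pauli labels form `F_2^{2n}`, with commutation
given by the symplectic form. The subspace `{(0, z)}` and the graphs `{(x, M_c x)}`, for `c` in the
field with `2^n` elements and `M_c` the Gram matrix of `Tr(c x y)`, are Lagrangian and cover each
nonzero label exactly once. -/

/-! ### Characters of the group of binary vectors -/

/-- The sign `(-1)^{k · b}`. -/
def bitSign {n : ℕ} (k b : Bits n) : ℂ := (-1) ^ (∑ i, (k i : ℕ) * (b i : ℕ))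

lemma bitSign_comm {n : ℕ} (k b : Bits n) : bitSign k b = bitSign b k := by
  simp only [bitSign, mul_comm]

lemma bitSign_eq_prod {n : ℕ} (k b : Bits n) :
    bitSign k b = ∏ i, (-1 : ℂ) ^ ((k i : ℕ) * (b i : ℕ)) := by
  rw [bitSign, Finset.prod_pow_eq_pow_sum]

lemma bitSign_add_left {n : ℕ} (k l b : Bits n) :
    bitSign (k + l) b = bitSign k b * bitSign l b := by
  have h : ∀ u v w : Fin 2, (-1 : ℂ) ^ (((u + v : Fin 2) : ℕ) * (w : ℕ)) =
      (-1) ^ ((u : ℕ) * (w : ℕ)) * (-1) ^ ((v : ℕ) * (w : ℕ)) := by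
    intro u v w
    fin_cases u <;> fin_cases v <;> fin_cases w <;> simp
  simp only [bitSign_eq_prod, ← Finset.prod_mul_distrib, Pi.add_apply, h]

lemma bitSign_add_right {n : ℕ} (k l b : Bits n) :
    bitSign b (k + l) = bitSign b k * bitSign b l := by
  rw [bitSign_comm, bitSign_add_left, bitSign_comm k, bitSign_comm l]

@[simp] lemma bitSign_zero_left {n : ℕ} (b : Bits n) : bitSign 0 b = 1 := by
  simp [bitSign]

@[simp] lemma bitSign_zero_right {n : ℕ} (b : Bits n) : bitSign b 0 = 1 := by
  simp [bitSign]

@[simp] lemma bitSign_mul_self {n : ℕ} (k b : Bits n) : bitSign k b * bitSign k b = 1 := by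
  rw [bitSign, ← mul_pow]; simp

lemma bitSign_ne_zero {n : ℕ} (k b : Bits n) : bitSign k b ≠ 0 := by
  simp [bitSign]

@[simp] lemma star_bitSign {n : ℕ} (k b : Bits n) : star (bitSign k b) = bitSign k b := by
  simp [bitSign]

lemma sum_bitSign {n : ℕ} (k : Bits n) :
    ∑ b, bitSign k b = if k = 0 then 2 ^ n else 0 := by
  have h : ∀ u : Fin 2, ∑ w : Fin 2, (-1 : ℂ) ^ ((u : ℕ) * (w : ℕ)) = if u = 0 then 2 else 0 := by
    intro u
    fin_cases u <;> norm_num [Fin.sum_univ_two]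
  simp only [bitSign_eq_prod]
  rw [← Fintype.prod_sum (fun i (w : Fin 2) => (-1 : ℂ) ^ ((k i : ℕ) * (w : ℕ)))]
  simp only [h]
  split_ifs with hk
  · simp [hk]
  · obtain ⟨i, hi⟩ := Function.ne_iff.mp hk
    exact Finset.prod_eq_zero (Finset.mem_univ i) (if_neg hi)

lemma Bits.add_self {n : ℕ} (k : Bits n) : k + k = 0 := by
  have h : ∀ u : Fin 2, u + u = 0 := by decide
  exact funext fun i => h (k i)

lemma Bits.neg_eq {n : ℕ} (k : Bits n) : -k = k :=
  neg_eq_of_add_eq_zero_left (Bits.add_self k)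

lemma Bits.eq_add_iff {n : ℕ} (k l x : Bits n) : k = l + x ↔ l = k + x := by
  constructor <;> rintro rfl <;> rw [add_assoc, Bits.add_self, add_zero]

lemma Bits.add_eq_zero_iff {n : ℕ} (k l : Bits n) : k + l = 0 ↔ k = l := by
  rw [add_eq_zero_iff_eq_neg, Bits.neg_eq]

/-- Distinct binary vectors define distinct characters. -/
lemma eq_of_bitSign_eq {n : ℕ} {k l : Bits n} (h : ∀ b, bitSign k b = bitSign l b) : k = l := by
  have h1 : ∑ b, bitSign (k + l) b = 2 ^ n := by
    simp [bitSign_add_left, h]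
  rw [sum_bitSign] at h1
  by_contra hkl
  rw [if_neg (by rwa [Bits.add_eq_zero_iff])] at h1
  exact pow_ne_zero n two_ne_zero h1.symm

/-! ### Matrix entries, commutation and twirls of Pauli operators -/

lemma opX_apply {n : ℕ} (x k l : Bits n) : opX x k l = if k = l + x then 1 else 0 := by
  have h : ∀ u v w : Fin 2, (pauliX ^ (u : ℕ)) v w = if v = w + u then 1 else 0 := by
    intro u v w
    fin_cases u <;> fin_cases v <;> fin_cases w <;> simp [pauliX]
  simp only [opX, tensorOp, Matrix.of_apply, h, funext_iff, Pi.add_apply]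
  rw [Finset.prod_ite_zero]
  simp

lemma opZ_apply {n : ℕ} (z k l : Bits n) : opZ z k l = if k = l then bitSign z l else 0 := by
  have h : ∀ u v w : Fin 2, (pauliZ ^ (u : ℕ)) v w =
      if v = w then (-1) ^ ((u : ℕ) * (w : ℕ)) else 0 := by
    intro u v w
    fin_cases u <;> fin_cases v <;> fin_cases w <;> simp [pauliZ]
  simp only [opZ, tensorOp, Matrix.of_apply, h, bitSign_eq_prod]
  rw [Finset.prod_ite_zero]
  simp [funext_iff]

lemma opZ_eq_diagonal {n : ℕ} (z : Bits n) : opZ z = Matrix.diagonal (bitSign z) := by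
  ext k l
  rw [opZ_apply, Matrix.diagonal_apply]
  split_ifs with h <;> simp [h]

lemma opZ_zero {n : ℕ} : opZ (0 : Bits n) = 1 := by
  ext k l
  simp [opZ_apply, Matrix.one_apply]

/-- The phase `∏ᵢ i^{xᵢ zᵢ}` of a Pauli operator. -/
def pauliPhase {n : ℕ} (a : Bits n × Bits n) : ℂ :=
  Complex.I ^ (∑ i, (a.1 i : ℕ) * (a.2 i : ℕ))

lemma pauliPhase_ne_zero {n : ℕ} (a : Bits n × Bits n) : pauliPhase a ≠ 0 := by
  simp [pauliPhase]

lemma pauliPhase_mul_self {n : ℕ} (a : Bits n × Bits n) :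
    pauliPhase a * pauliPhase a = bitSign a.1 a.2 := by
  rw [pauliPhase, ← mul_pow, Complex.I_mul_I, bitSign]

lemma pauli_apply {n : ℕ} (a : Bits n × Bits n) (k l : Bits n) :
    pauli a k l = if k = l + a.1 then pauliPhase a * bitSign a.2 l else 0 := by
  simp [pauli, pauliPhase, Matrix.mul_apply, opX_apply, opZ_apply]

lemma pauli_zero_left {n : ℕ} (z : Bits n) : pauli (0, z) = opZ z := by
  ext k l
  simp [pauli_apply, opZ_apply, pauliPhase]

lemma pauli_zero {n : ℕ} : pauli (0 : Bits n × Bits n) = 1 := by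
  ext k l
  simp [pauli_apply, pauliPhase, Matrix.one_apply]

lemma pauli_injective {n : ℕ} : Function.Injective (pauli (n := n)) := by
  intro a b h
  have h1 : a.1 = b.1 := by
    have := congrFun (congrFun h a.1) 0
    rw [pauli_apply, pauli_apply, zero_add, zero_add, if_pos rfl] at this
    by_contra hab
    rw [if_neg hab] at this
    exact mul_ne_zero (pauliPhase_ne_zero a) (bitSign_ne_zero _ _) this
  have h2 : ∀ l, pauliPhase a * bitSign a.2 l = pauliPhase b * bitSign b.2 l := by
    intro l
    have := congrFun (congrFun h (l + a.1)) l
    rwa [pauli_apply, pauli_apply, if_pos rfl, if_pos (by rw [h1])] at this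
  have h3 : pauliPhase a = pauliPhase b := by simpa using h2 0
  refine Prod.ext h1 (eq_of_bitSign_eq fun l => ?_)
  have := h2 l
  rw [h3] at this
  exact mul_left_cancel₀ (pauliPhase_ne_zero b) this

lemma pauli_mul_apply {n : ℕ} (a b : Bits n × Bits n) (k l : Bits n) :
    (pauli a * pauli b) k l = if k = l + (a.1 + b.1) then
      pauliPhase a * pauliPhase b * bitSign (a.2 + b.2) l * bitSign a.2 b.1 else 0 := by
  simp only [Matrix.mul_apply, pauli_apply, mul_ite, mul_zero]
  rw [Finset.sum_ite_eq' Finset.univ (l + b.1)]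
  simp only [Finset.mem_univ, if_true, ite_mul, zero_mul, bitSign_add_left, bitSign_add_right]
  rw [show l + b.1 + a.1 = l + (a.1 + b.1) by abel]
  split_ifs <;> ring

/-- Two Pauli operators commute iff the symplectic form of their labels vanishes. -/
lemma pauli_commute_iff {n : ℕ} (a b : Bits n × Bits n) :
    pauli a * pauli b = pauli b * pauli a ↔ bitSign a.2 b.1 = bitSign b.2 a.1 := by
  constructor
  · intro h
    have := congrFun (congrFun h (a.1 + b.1)) 0
    rw [pauli_mul_apply, pauli_mul_apply, if_pos (by simp), if_pos (by simp [add_comm])] at this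
    simp only [bitSign_zero_right, mul_one] at this
    rw [mul_comm (pauliPhase b)] at this
    exact mul_left_cancel₀ (mul_ne_zero (pauliPhase_ne_zero a) (pauliPhase_ne_zero b)) this
  · intro h
    ext k l
    rw [pauli_mul_apply, pauli_mul_apply, h, add_comm b.1, add_comm b.2,
      mul_comm (pauliPhase b)]

lemma sandwich_apply {n : ℕ} (A B ρ : QOp n) : sandwich A B ρ = A * (ρ * B) := rfl

/-- The two phases multiply to `(-1)^{x · z}`, which cancels the sign left by evaluating the `Z`
part at shifted indices. -/
lemma pauli_conj_apply {n : ℕ} (a : Bits n × Bits n) (ρ : QOp n) (k l : Bits n) :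
    sandwich (pauli a) (pauli a) ρ k l =
      bitSign a.2 (k + l) * ρ (k + a.1) (l + a.1) := by
  simp only [sandwich_apply, Matrix.mul_apply, pauli_apply, ite_mul, zero_mul, mul_ite, mul_zero]
  simp_rw [Bits.eq_add_iff k]
  rw [Finset.sum_ite_eq' Finset.univ (k + a.1)]
  rw [if_pos (Finset.mem_univ _), Finset.sum_ite_eq' Finset.univ (l + a.1),
    if_pos (Finset.mem_univ _)]
  have h := pauliPhase_mul_self a
  have h' := bitSign_mul_self a.2 a.1
  rw [bitSign_comm] at h
  rw [bitSign_add_right, bitSign_add_right]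
  linear_combination (bitSign a.2 k * bitSign a.2 a.1 * bitSign a.2 l * ρ (k + a.1) (l + a.1)) * h +
    (bitSign a.2 k * bitSign a.2 l * ρ (k + a.1) (l + a.1)) * h'

/-- The Pauli twirl of an operator is a multiple of the identity. -/
lemma sum_pauli_conj {n : ℕ} (ρ : QOp n) :
    ∑ a, sandwich (pauli a) (pauli a) ρ = ((2 : ℂ) ^ n * ρ.trace) • (1 : QOp n) := by
  ext k l
  simp only [Matrix.sum_apply, pauli_conj_apply, Fintype.sum_prod_type, ← Finset.sum_mul,
    Matrix.smul_apply, Matrix.one_apply, smul_eq_mul]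
  have h : ∑ z, bitSign z (k + l) = if k = l then 2 ^ n else 0 := by
    simp_rw [bitSign_comm _ (k + l), sum_bitSign, Bits.add_eq_zero_iff]
  simp_rw [h, ← Finset.mul_sum]
  split_ifs with hkl
  · subst hkl
    -- Translation by `k` permutes the binary vectors, so the shifted diagonal still sums to the
    -- trace.
    rw [mul_one, Matrix.trace, ← Equiv.sum_comp (Equiv.addLeft k) (Matrix.diag ρ)]
    rfl
  · simp

/-- Averaging over the conjugations by `Z_a` removes the off-diagonal entries. -/
lemma sum_opZ_conj {n : ℕ} (ρ : QOp n) :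
    ∑ a, opZ a * ρ * opZ a = (2 : ℂ) ^ n • Matrix.diagonal fun k => ρ k k := by
  ext k l
  simp only [Matrix.sum_apply, opZ_eq_diagonal, Matrix.mul_diagonal, Matrix.diagonal_mul,
    Matrix.smul_apply, Matrix.diagonal_apply, smul_eq_mul]
  have h : ∀ a, bitSign a k * ρ k l * bitSign a l = bitSign (k + l) a * ρ k l := fun a => by
    rw [bitSign_add_left, bitSign_comm a k, bitSign_comm a l]; ring
  simp_rw [h, ← Finset.sum_mul, sum_bitSign, Bits.add_eq_zero_iff]
  split_ifs with hkl
  · rw [hkl]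
  · simp

/-! ### Binary linear algebra and quadratic phases -/

/-- A binary vector as a vector over the field with two elements. -/
def bitVec {n : ℕ} (x : Bits n) : Fin n → ZMod 2 := x

/-- A vector over the field with two elements as a binary vector. -/
def ofBitVec {n : ℕ} (v : Fin n → ZMod 2) : Bits n := v

@[simp] lemma bitVec_ofBitVec {n : ℕ} (v : Fin n → ZMod 2) : bitVec (ofBitVec v) = v := rfl

@[simp] lemma bitVec_zero {n : ℕ} : bitVec (0 : Bits n) = 0 := rfl

lemma bitVec_injective {n : ℕ} : Function.Injective (bitVec (n := n)) := fun _ _ h => h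

/-- An integer lift of a binary vector. -/
def bitLift {n : ℕ} (x : Bits n) : Fin n → ℤ := fun i => ((x i : ℕ) : ℤ)

lemma intCast_bitLift {n : ℕ} (x : Bits n) (i : Fin n) : ((bitLift x i : ℤ) : ZMod 2) =
    bitVec x i := by
  have h : ∀ u : ZMod 2, ((u.val : ℤ) : ZMod 2) = u := by decide
  exact h (bitVec x i)

@[simp] lemma bitLift_zero {n : ℕ} : bitLift (0 : Bits n) = 0 := rfl

lemma bitLift_add {n : ℕ} (k l : Bits n) :
    bitLift (k + l) = bitLift k + bitLift l - (2 : ℤ) • (bitLift k * bitLift l) := by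
  have h : ∀ u v : Fin 2, (((u + v : Fin 2) : ℕ) : ℤ) =
      (u : ℕ) + (v : ℕ) - 2 * ((u : ℕ) * (v : ℕ)) := by
    decide
  exact funext fun i => h (k i) (l i)

/-- Only the parity of the exponent matters, so signs can be written with integer bilinear forms,
compatible with powers of `i`. -/
lemma bitSign_eq_zpow {n : ℕ} (k b : Bits n) (z : ℤ) (h : (z : ZMod 2) = bitVec k ⬝ᵥ bitVec b) :
    bitSign k b = (-1 : ℂ) ^ z := by
  have h1 : ((bitLift k ⬝ᵥ bitLift b : ℤ) : ZMod 2) = z := by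
    rw [h]
    simp [dotProduct, intCast_bitLift]
  have h2 : bitSign k b = (-1 : ℂ) ^ (bitLift k ⬝ᵥ bitLift b) := by
    rw [bitSign, ← zpow_natCast]
    congr 1
    simp [dotProduct, bitLift]
  rw [ZMod.intCast_eq_intCast_iff_dvd_sub] at h1
  obtain ⟨t, ht⟩ := h1
  rw [h2, eq_add_of_sub_eq ht, zpow_add₀ (by norm_num), zpow_mul]
  norm_num

lemma bitSign_eq_of_dotProduct_eq {n : ℕ} {k b k' b' : Bits n}
    (h : bitVec k ⬝ᵥ bitVec b = bitVec k' ⬝ᵥ bitVec b') : bitSign k b = bitSign k' b' := by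
  obtain ⟨z, hz⟩ := ZMod.intCast_surjective (bitVec k ⬝ᵥ bitVec b)
  rw [bitSign_eq_zpow k b z hz, bitSign_eq_zpow k' b' z (hz.trans h)]

/-- The action of a binary matrix on binary vectors. -/
def mulBits {n : ℕ} (M : Matrix (Fin n) (Fin n) (ZMod 2)) (x : Bits n) : Bits n :=
  ofBitVec (M *ᵥ bitVec x)

@[simp] lemma mulBits_zero {n : ℕ} (M : Matrix (Fin n) (Fin n) (ZMod 2)) :
    mulBits M 0 = 0 := by
  simp only [mulBits, bitVec_zero, Matrix.mulVec_zero]; rfl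

lemma bitSign_mulBits {n : ℕ} {M : Matrix (Fin n) (Fin n) (ZMod 2)} (hM : M.IsSymm)
    (x y : Bits n) : bitSign (mulBits M x) y = bitSign (mulBits M y) x := by
  apply bitSign_eq_of_dotProduct_eq
  simp only [mulBits, bitVec_ofBitVec]
  rw [dotProduct_comm, Matrix.dotProduct_mulVec, ← Matrix.mulVec_transpose, hM.eq]

/-- The integer lift of a binary matrix. -/
def matLift {n : ℕ} (M : Matrix (Fin n) (Fin n) (ZMod 2)) : Matrix (Fin n) (Fin n) ℤ :=
  M.map fun u => (u.val : ℤ)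

lemma bitSign_mulBits_eq_zpow {n : ℕ} (M : Matrix (Fin n) (Fin n) (ZMod 2)) (x y : Bits n) :
    bitSign (mulBits M x) y = (-1 : ℂ) ^ (bitLift y ⬝ᵥ matLift M *ᵥ bitLift x) := by
  rw [bitSign_comm]
  apply bitSign_eq_zpow
  simp [mulBits, dotProduct, Matrix.mulVec, intCast_bitLift, matLift]

/-- The phase `i ^ (xᵀ M x)`, with `M` and `x` lifted to the integers. -/
def quadPhase {n : ℕ} (M : Matrix (Fin n) (Fin n) (ZMod 2)) (x : Bits n) : ℂ :=
  Complex.I ^ (bitLift x ⬝ᵥ matLift M *ᵥ bitLift x)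

lemma quadPhase_mul_star {n : ℕ} (M : Matrix (Fin n) (Fin n) (ZMod 2)) (x : Bits n) :
    quadPhase M x * star (quadPhase M x) = 1 := by
  rw [quadPhase, star_zpow₀, ← mul_zpow]
  simp

lemma quadPhase_mul_self {n : ℕ} (M : Matrix (Fin n) (Fin n) (ZMod 2)) (x : Bits n) :
    quadPhase M x * quadPhase M x = bitSign (mulBits M x) x := by
  rw [quadPhase, ← mul_zpow, Complex.I_mul_I, bitSign_mulBits_eq_zpow]

/-- Powers of `i` need the quadratic form modulo 4. Lifting a binary sum gives `x + y - 2xy`; by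
symmetry of `M`, the correction changes the form by a multiple of 4, and the cross term `2 xᵀMy`
becomes a sign. -/
lemma quadPhase_add {n : ℕ} {M : Matrix (Fin n) (Fin n) (ZMod 2)} (hM : M.IsSymm)
    (x y : Bits n) :
    quadPhase M (x + y) = quadPhase M x * quadPhase M y * bitSign (mulBits M y) x := by
  have hN : (matLift M).IsSymm := hM.map _
  have hsymm : ∀ u v : Fin n → ℤ, u ⬝ᵥ matLift M *ᵥ v = v ⬝ᵥ matLift M *ᵥ u := fun u v => by
    rw [dotProduct_comm v, Matrix.dotProduct_mulVec, ← Matrix.mulVec_transpose, hN.eq]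
  have hQ : bitLift (x + y) ⬝ᵥ matLift M *ᵥ bitLift (x + y) =
      bitLift x ⬝ᵥ matLift M *ᵥ bitLift x + bitLift y ⬝ᵥ matLift M *ᵥ bitLift y +
        2 * (bitLift x ⬝ᵥ matLift M *ᵥ bitLift y) +
        4 * ((bitLift x * bitLift y) ⬝ᵥ matLift M *ᵥ (bitLift x * bitLift y) -
          (bitLift x * bitLift y) ⬝ᵥ matLift M *ᵥ bitLift x -
          (bitLift x * bitLift y) ⬝ᵥ matLift M *ᵥ bitLift y) := by
    rw [bitLift_add]
    simp only [Matrix.mulVec_add, Matrix.mulVec_sub, Matrix.mulVec_smul, add_dotProduct,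
      sub_dotProduct, smul_dotProduct, dotProduct_add, dotProduct_sub, dotProduct_smul, smul_eq_mul]
    rw [hsymm (bitLift y) (bitLift x), hsymm (bitLift x) (bitLift x * bitLift y),
      hsymm (bitLift y) (bitLift x * bitLift y)]
    ring
  have h2 : Complex.I ^ (2 : ℤ) = -1 := by
    rw [show (2 : ℤ) = ((2 : ℕ) : ℤ) from rfl, zpow_natCast, Complex.I_sq]
  have h4 : Complex.I ^ (4 : ℤ) = 1 := by
    rw [show (4 : ℤ) = ((4 : ℕ) : ℤ) from rfl, zpow_natCast, Complex.I_pow_four]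
  rw [quadPhase, hQ, zpow_add₀ Complex.I_ne_zero, zpow_add₀ Complex.I_ne_zero,
    zpow_add₀ Complex.I_ne_zero, zpow_mul, zpow_mul, h2, h4, one_zpow, mul_one,
    bitSign_mulBits_eq_zpow]
  rfl

/-! ### Unitaries diagonalizing the graph subspaces -/

/-- The unitary whose columns are the joint eigenvectors of the Paulis with labels `(x, M x)`. -/
def graphUnitary {n : ℕ} (M : Matrix (Fin n) (Fin n) (ZMod 2)) : QOp n :=
  Matrix.of fun k b => ((Real.sqrt (2 ^ n))⁻¹ : ℝ) * quadPhase M k * bitSign k b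

/-- Character orthogonality in the column index forces `k = l + a`; the cocycle rule `quadPhase_add`
then evaluates the remaining phase. The case `a = 0` is unitarity. -/
lemma graphUnitary_conj_opZ {n : ℕ} {M : Matrix (Fin n) (Fin n) (ZMod 2)} (hM : M.IsSymm)
    (a : Bits n) (k l : Bits n) :
    (graphUnitary M * opZ a * (graphUnitary M)ᴴ) k l =
      if k = l + a then quadPhase M a * bitSign (mulBits M a) l else 0 := by
  have hs : (((Real.sqrt (2 ^ n))⁻¹ : ℝ) : ℂ) * (((Real.sqrt (2 ^ n))⁻¹ : ℝ) : ℂ) = (2 ^ n)⁻¹ := by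
    rw [← Complex.ofReal_mul, ← mul_inv, Real.mul_self_sqrt (by positivity)]
    push_cast; rfl
  have h : ∀ b, (((Real.sqrt (2 ^ n))⁻¹ : ℝ) : ℂ) * quadPhase M k * bitSign k b * bitSign a b *
      star ((((Real.sqrt (2 ^ n))⁻¹ : ℝ) : ℂ) * quadPhase M l * bitSign l b) =
      (2 ^ n)⁻¹ * quadPhase M k * star (quadPhase M l) * bitSign (k + (l + a)) b := fun b => by
    rw [star_mul', star_mul', star_bitSign, Complex.star_def, Complex.conj_ofReal,
      bitSign_add_left, bitSign_add_left, ← hs]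
    ring
  rw [opZ_eq_diagonal, Matrix.mul_apply]
  simp only [Matrix.mul_diagonal, graphUnitary, Matrix.conjTranspose_apply, Matrix.of_apply]
  simp_rw [h, ← Finset.mul_sum, sum_bitSign, Bits.add_eq_zero_iff]
  split_ifs with hk
  · rw [hk, quadPhase_add hM]
    have h1 := quadPhase_mul_star M l
    have h2 : ((2 : ℂ) ^ n)⁻¹ * 2 ^ n = 1 := inv_mul_cancel₀ (by simp)
    linear_combination (quadPhase M a * bitSign (mulBits M a) l) *
      (((2 : ℂ) ^ n)⁻¹ * 2 ^ n * h1 + h2)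
  · simp

lemma graphUnitary_mem {n : ℕ} {M : Matrix (Fin n) (Fin n) (ZMod 2)} (hM : M.IsSymm) :
    graphUnitary M ∈ Matrix.unitaryGroup (Bits n) ℂ := by
  rw [Matrix.mem_unitaryGroup_iff]
  ext k l
  have h := graphUnitary_conj_opZ hM 0 k l
  rw [opZ_zero, mul_one] at h
  rw [Matrix.star_eq_conjTranspose, h]
  simp [Matrix.one_apply, quadPhase]

lemma exists_sign_pauli_eq {n : ℕ} {M : Matrix (Fin n) (Fin n) (ZMod 2)} (hM : M.IsSymm)
    (a : Bits n) : ∃ s : ℤˣ, pauli (a, mulBits M a) =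
      ((s : ℤ) : ℂ) • (graphUnitary M * opZ a * (graphUnitary M)ᴴ) := by
  have h : ∀ s : ℤˣ, pauliPhase (a, mulBits M a) = ((s : ℤ) : ℂ) * quadPhase M a →
      pauli (a, mulBits M a) =
        ((s : ℤ) : ℂ) • (graphUnitary M * opZ a * (graphUnitary M)ᴴ) := fun s hs => by
    ext k l
    rw [pauli_apply, Matrix.smul_apply, graphUnitary_conj_opZ hM, hs, smul_eq_mul, mul_ite,
      mul_zero, mul_assoc]
  -- Both phases are square roots of the same sign, hence agree up to `±1`.
  have h2 : pauliPhase (a, mulBits M a) * pauliPhase (a, mulBits M a) =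
      quadPhase M a * quadPhase M a := by
    rw [pauliPhase_mul_self, quadPhase_mul_self, bitSign_comm]
  rcases mul_self_eq_mul_self_iff.mp h2 with h3 | h3
  · exact ⟨1, h 1 (by simpa using h3)⟩
  · exact ⟨-1, h (-1) (by simpa using h3)⟩

/-! ### Symplectic spreads and existence of diagonalizing families -/

/-- A family of `2 ^ n` symmetric binary matrices with invertible differences. -/
lemma exists_symmetric_spread {n : ℕ} (hn : n ≠ 0) :
    ∃ M : Fin (2 ^ n) → Matrix (Fin n) (Fin n) (ZMod 2), (∀ c, (M c).IsSymm) ∧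
      ∀ x : Bits n, x ≠ 0 → Function.Bijective fun c => mulBits (M c) x := by
  let K := GaloisField 2 n
  have : Fintype K := Fintype.ofFinite K
  let b : Module.Basis (Fin n) (ZMod 2) K :=
    Module.finBasisOfFinrankEq (ZMod 2) K (GaloisField.finrank 2 hn)
  have hcard : Fintype.card K = 2 ^ n := by
    rw [← Nat.card_eq_fintype_card, GaloisField.card 2 n hn]
  let e : Fin (2 ^ n) ≃ K := (Fintype.equivFinOfCardEq hcard).symm
  refine ⟨fun c => Matrix.of fun i j => Algebra.trace (ZMod 2) K (e c * b i * b j), ?_, ?_⟩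
  · intro c
    ext i j
    simp only [Matrix.transpose_apply, Matrix.of_apply]
    rw [mul_right_comm]
  · intro x hx
    rw [Fintype.bijective_iff_injective_and_card]
    refine ⟨fun c d hcd => ?_, by simp⟩
    -- The field element with coordinates `x`: the vector `M_c x` lists the values `Tr(c X b_i)`, so
    -- it determines `c X` by nondegeneracy of the trace form, and then `c` because `X ≠ 0`.
    let X : K := ∑ j, bitVec x j • b j
    have hX : X ≠ 0 := by
      intro h0
      have := Fintype.linearIndependent_iff.mp b.linearIndependent (bitVec x) h0
      exact hx (bitVec_injective (funext this))
    have happ : ∀ (c : Fin (2 ^ n)) (i : Fin n),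
        ((Matrix.of fun i j => Algebra.trace (ZMod 2) K (e c * b i * b j)) *ᵥ bitVec x) i =
          Algebra.trace (ZMod 2) K (e c * X * b i) := by
      intro c i
      have h : e c * X * b i = ∑ j, bitVec x j • (e c * b i * b j) := by
        rw [mul_right_comm, Finset.mul_sum]
        exact Finset.sum_congr rfl fun j _ => mul_smul_comm _ _ _
      rw [h, map_sum]
      simp only [Matrix.mulVec, dotProduct]
      refine Finset.sum_congr rfl fun j _ => ?_
      rw [map_smul, smul_eq_mul, mul_comm, Matrix.of_apply]
    have hcd' : ∀ i, Algebra.trace (ZMod 2) K (e c * X * b i) =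
        Algebra.trace (ZMod 2) K (e d * X * b i) := fun i => by
      rw [← happ, ← happ]; exact congrFun hcd i
    have hform : Algebra.traceForm (ZMod 2) K (e c * X) = Algebra.traceForm (ZMod 2) K (e d * X) :=
      b.ext fun i => by simpa only [Algebra.traceForm_apply] using hcd' i
    have hinj : e c * X = e d * X := by
      have hnd := (traceForm_nondegenerate (ZMod 2) K).1
      rw [← sub_eq_zero]
      refine hnd _ fun y => ?_
      rw [map_sub, hform, sub_self, LinearMap.zero_apply]
    exact e.injective (mul_right_cancel₀ hX hinj)

/-- The non-identity Paulis split into commuting sets according to a spread of Lagrangian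
subspaces, each parametrized by `L j`. -/
lemma isMaxCommutingPartition_of_spread {n : ℕ}
    (L : Fin (2 ^ n + 1) → Bits n → Bits n × Bits n)
    (hinj : ∀ j, Function.Injective (L j)) (hzero : ∀ j, L j 0 = 0)
    (hiso : ∀ j w, (∀ a, bitSign (L j a).2 w.1 = bitSign w.2 (L j a).1) ↔ ∃ a, L j a = w)
    (hspread : ∀ w, w ≠ 0 → ∃! j, ∃ a, L j a = w) :
    IsMaxCommutingPartition fun j => {P | ∃ a : Bits n, a ≠ 0 ∧ P = pauli (L j a)} := by
  have hne : ∀ j a, a ≠ 0 → L j a ≠ 0 := fun j a ha h => ha (hinj j (h.trans (hzero j).symm))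
  refine ⟨?_, ?_, ?_, ?_, ?_⟩
  · intro i j hij
    rw [Set.disjoint_left]
    rintro _ ⟨a, ha, rfl⟩ ⟨b, _, hb⟩
    exact hij ((hspread _ (hne i a ha)).unique ⟨a, rfl⟩ ⟨b, (pauli_injective hb).symm⟩)
  · ext P
    simp only [Set.mem_iUnion, Set.mem_ofPred_eq, nonIdPaulis]
    constructor
    · rintro ⟨j, a, ha, rfl⟩
      exact ⟨_, hne j a ha, rfl⟩
    · rintro ⟨w, hw, rfl⟩
      obtain ⟨j, ⟨a, rfl⟩, _⟩ := hspread w hw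
      exact ⟨j, a, fun h => hw (by rw [h, hzero]), rfl⟩
  · intro j
    have h : {P | ∃ a : Bits n, a ≠ 0 ∧ P = pauli (L j a)} =
        (fun a => pauli (L j a)) '' {0}ᶜ := by
      ext P
      simp only [Set.mem_ofPred_eq, Set.mem_image, Set.mem_compl_iff, Set.mem_singleton_iff,
        eq_comm]
    rw [h, Set.ncard_image_of_injective _ fun a b hab => hinj j (pauli_injective hab),
      Set.ncard_compl, Set.ncard_singleton]
    simp
  · rintro j _ ⟨a, _, rfl⟩ _ ⟨b, _, rfl⟩
    rw [pauli_commute_iff]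
    exact (hiso j _).mpr ⟨b, rfl⟩ a
  · rintro j _ ⟨w, hw, rfl⟩ hcomm
    obtain ⟨a, rfl⟩ := (hiso j w).mp fun a => by
      by_cases ha : a = 0
      · simp [ha, hzero]
      · exact (pauli_commute_iff _ _).mp (hcomm _ ⟨a, ha, rfl⟩)
    exact ⟨a, fun h => hw (by rw [h, hzero]), rfl⟩

/-- A nonzero label `(x, z)` lies in the vertical subspace if `x = 0`, and otherwise in the graph of
the unique `M_c` with `M_c x = z`. The vertical subspace consists of the `Z_a`, diagonalized by the
identity. -/
theorem exists_isDiagonalizingFamily {n : ℕ} (hn : n ≠ 0) :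
    ∃ V : Fin (2 ^ n + 1) → Matrix.unitaryGroup (Bits n) ℂ, IsDiagonalizingFamily V := by
  obtain ⟨M, hM, hbij⟩ := exists_symmetric_spread hn
  let L : Fin (2 ^ n + 1) → Bits n → Bits n × Bits n :=
    Fin.cases (fun z => (0, z)) (fun c x => (x, mulBits (M c) x))
  have hL0 : ∀ z, L 0 z = (0, z) := fun _ => rfl
  have hLs : ∀ c x, L (Fin.succ c) x = (x, mulBits (M c) x) := fun _ _ => rfl
  choose s hs using fun c => exists_sign_pauli_eq (hM c)
  refine ⟨Fin.cases 1 fun c => ⟨graphUnitary (M c), graphUnitary_mem (hM c)⟩, _,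
    Fin.cases (fun _ => 1) s, isMaxCommutingPartition_of_spread L ?_ ?_ ?_ ?_, ?_⟩
  · refine Fin.cases ?_ fun c => ?_
    · intro a b h
      exact (Prod.ext_iff.mp h).2
    · intro a b h
      exact (Prod.ext_iff.mp h).1
  · exact Fin.cases rfl fun c => by rw [hLs, mulBits_zero]; rfl
  · refine Fin.cases ?_ fun c => ?_
    · rintro ⟨x, z⟩
      simp only [hL0, bitSign_zero_right, Prod.mk.injEq]
      constructor
      · intro h
        refine ⟨z, (eq_of_bitSign_eq fun b => ?_).symm, rfl⟩
        rw [bitSign_comm, h, bitSign_zero_left]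
      · rintro ⟨_, rfl, _⟩ a
        simp
    · rintro ⟨x, z⟩
      simp only [hLs, Prod.mk.injEq]
      constructor
      · intro h
        refine ⟨x, rfl, eq_of_bitSign_eq fun b => ?_⟩
        rw [bitSign_mulBits (hM c), h]
      · rintro ⟨_, rfl, rfl⟩ a
        exact bitSign_mulBits (hM c) _ _
  · rintro ⟨x, z⟩ hw
    by_cases hx : x = 0
    · subst hx
      have hz : z ≠ 0 := fun h => hw (by rw [h]; rfl)
      refine ⟨0, ⟨z, rfl⟩, fun j => ?_⟩
      refine Fin.cases (fun _ => rfl) (fun c => ?_) j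
      rintro ⟨a, ha⟩
      rw [hLs, Prod.mk.injEq] at ha
      obtain ⟨rfl, ha⟩ := ha
      exact absurd (by rw [← ha, mulBits_zero]) hz
    · obtain ⟨c, hc, huniq⟩ := (hbij x hx).existsUnique z
      refine ⟨c.succ, ⟨x, by rw [hLs]; exact Prod.ext rfl hc⟩, fun j => ?_⟩
      refine Fin.cases ?_ (fun d => ?_) j
      · rintro ⟨a, ha⟩
        exact absurd (Prod.ext_iff.mp ha).1.symm hx
      · rintro ⟨a, ha⟩
        rw [hLs, Prod.mk.injEq] at ha
        obtain ⟨rfl, ha⟩ := ha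
        exact congrArg Fin.succ (huniq d ha)
  · refine Fin.cases ?_ fun c => ?_
    · ext P
      simp [hL0, pauli_zero_left]
    · ext P
      simp only [Set.mem_ofPred_eq, hLs, hs, Fin.cases_succ]

/-! ### Completely positive maps -/

/-- Relabelling the reference basis is harmless. This gives access to the reference `Bits n` of the
entanglement fidelity and to the trivial reference `Unit`. -/
lemma IsCompletelyPositive.posSemidef_ampliation {n : ℕ} {Φ : SuperOp n}
    (hΦ : IsCompletelyPositive Φ) {R : Type} [Fintype R]
    {M : Matrix (R × Bits n) (R × Bits n) ℂ} (hM : M.PosSemidef) :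
    (ampliation R Φ M).PosSemidef := by
  let e : Fin (Fintype.card R) ≃ R := (Fintype.equivFin R).symm
  rw [← Matrix.posSemidef_submatrix_equiv (e.prodCongr (Equiv.refl (Bits n)))]
  exact hΦ _ _ (hM.submatrix (e.prodCongr (Equiv.refl (Bits n))))

lemma IsCompletelyPositive.comp {n : ℕ} {Φ Ψ : SuperOp n} (hΦ : IsCompletelyPositive Φ)
    (hΨ : IsCompletelyPositive Ψ) : IsCompletelyPositive (Φ ∘ₗ Ψ) :=
  fun d M hM => hΦ d _ (hΨ d M hM)

lemma IsCompletelyPositive.smul {n : ℕ} {Φ : SuperOp n} (hΦ : IsCompletelyPositive Φ) {r : ℝ}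
    (hr : 0 ≤ r) : IsCompletelyPositive ((r : ℂ) • Φ) :=
  fun d M hM => (hΦ d M hM).smul (a := (r : ℂ)) (by exact_mod_cast hr)

lemma IsCompletelyPositive.sum {n : ℕ} {ι : Type*} {s : Finset ι} {Φ : ι → SuperOp n}
    (hΦ : ∀ i ∈ s, IsCompletelyPositive (Φ i)) : IsCompletelyPositive (∑ i ∈ s, Φ i) := by
  intro d M hM
  have h : ampliation (Fin d) (∑ i ∈ s, Φ i) M = ∑ i ∈ s, ampliation (Fin d) (Φ i) M := by
    ext x y
    simp [ampliation, Matrix.sum_apply]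
  rw [h]
  exact Matrix.posSemidef_sum s fun i hi => hΦ i hi d M hM

lemma isCompletelyPositive_sandwich {n : ℕ} (A : QOp n) :
    IsCompletelyPositive (sandwich A Aᴴ) := by
  intro d M hM
  let B : Matrix (Fin d × Bits n) (Fin d × Bits n) ℂ :=
    Matrix.of fun x y => if x.1 = y.1 then A x.2 y.2 else 0
  have h : ampliation (Fin d) (sandwich A Aᴴ) M = B * (M * Bᴴ) := by
    ext x y
    simp only [ampliation, sandwich_apply, Matrix.of_apply, Matrix.mul_apply, B,
      Matrix.conjTranspose_apply, Fintype.sum_prod_type, ite_mul, zero_mul, apply_ite star,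
      star_zero, mul_ite, mul_zero]
    simp
  rw [h, ← mul_assoc]
  exact hM.mul_mul_conjTranspose_same B

/-! ### Channels -/

lemma IsChannel.comp {n : ℕ} {Φ Ψ : SuperOp n} (hΦ : IsChannel Φ) (hΨ : IsChannel Ψ) :
    IsChannel (Φ ∘ₗ Ψ) :=
  ⟨hΦ.1.comp hΨ.1, fun ρ => (hΦ.2 _).trans (hΨ.2 ρ)⟩

lemma isChannel_sandwich {n : ℕ} {A : QOp n} (hA : Aᴴ * A = 1) : IsChannel (sandwich A Aᴴ) :=
  ⟨isCompletelyPositive_sandwich A, fun ρ => by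
    rw [sandwich_apply, Matrix.trace_mul_comm, mul_assoc, hA, mul_one]⟩

lemma isChannel_twirl {n K : ℕ} (E : UnitaryEnsemble n K) {C : SuperOp n} (hC : IsChannel C) :
    IsChannel (twirl E C) := by
  have h : ∀ i, IsChannel (sandwich ((E.unitary i : QOp n)ᴴ) (E.unitary i : QOp n) ∘ₗ C ∘ₗ
      sandwich (E.unitary i : QOp n) ((E.unitary i : QOp n)ᴴ)) := fun i => by
    refine IsChannel.comp ?_ (hC.comp (isChannel_sandwich ?_))
    · have h1 := isChannel_sandwich (A := ((E.unitary i : QOp n)ᴴ)) (by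
        rw [Matrix.conjTranspose_conjTranspose]
        exact Unitary.coe_mul_star_self (E.unitary i))
      rwa [Matrix.conjTranspose_conjTranspose] at h1
    · exact Unitary.coe_star_mul_self (E.unitary i)
  refine ⟨IsCompletelyPositive.sum fun i _ => (h i).1.smul (E.prob_nonneg i), fun ρ => ?_⟩
  have h2 : ∑ i, (E.prob i : ℂ) = 1 := by exact_mod_cast E.prob_sum
  rw [twirl, LinearMap.sum_apply, Matrix.trace_sum]
  simp only [LinearMap.smul_apply, Matrix.trace_smul, (h _).2, smul_eq_mul]
  rw [← Finset.sum_mul, h2, one_mul]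

lemma two_pow_sub_one_ne_zero {n : ℕ} (hn : n ≠ 0) : (2 : ℂ) ^ n - 1 ≠ 0 := by
  have h : (1 : ℝ) < 2 ^ n := one_lt_pow₀ one_lt_two hn
  have h' : (2 : ℝ) ^ n - 1 ≠ 0 := by linarith
  exact_mod_cast h'

/-- A Kraus form with operators proportional to `|l⟩⟨k|`, from which complete positivity can be read
off. -/
lemma measurePrepare_eq_sum_sandwich (n : ℕ) :
    measurePrepare n = ∑ k : Bits n, ∑ l : Bits n,
      (((1 - if k = l then 1 else 0) / (2 ^ n - 1) : ℝ) : ℂ) •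
        sandwich (Matrix.single l k 1) (Matrix.single l k 1)ᴴ := by
  refine LinearMap.ext fun ρ => ?_
  simp only [measurePrepare, LinearMap.sum_apply, LinearMap.smul_apply,
    LinearMap.smulRight_apply, LinearMap.comp_apply, LinearMap.mulLeft_apply,
    Matrix.traceLinearMap_apply, preparedState, Finset.smul_sum, basisProj, sandwich_apply]
  refine Finset.sum_congr rfl fun k _ => Finset.sum_congr rfl fun l _ => ?_
  rw [smul_comm]
  congr 1
  rw [Matrix.conjTranspose_single, star_one, ← mul_assoc, Matrix.single_mul_mul_single,
    Matrix.trace_mul_comm]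
  simp [Matrix.trace_mul_single, Matrix.smul_single]

/-- The measure-and-prepare channel in terms of the trace and of the diagonal part. -/
lemma measurePrepare_apply {n : ℕ} (ρ : QOp n) :
    measurePrepare n ρ =
      ((2 : ℂ) ^ n - 1)⁻¹ • (ρ.trace • (1 : QOp n) - Matrix.diagonal fun k => ρ k k) := by
  rw [measurePrepare_eq_sum_sandwich]
  simp only [LinearMap.sum_apply, LinearMap.smul_apply, sandwich_apply,
    Matrix.conjTranspose_single, star_one, ← mul_assoc, Matrix.single_mul_mul_single]
  rw [Finset.sum_comm]
  ext i j
  simp only [Matrix.sum_apply, Matrix.smul_apply, Matrix.single_apply, smul_eq_mul, mul_one,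
    one_mul, Matrix.sub_apply, Matrix.one_apply, Matrix.diagonal_apply]
  by_cases hij : i = j
  · subst hij
    have h : ∀ l : Bits n, (∑ k, ((((1 - if k = l then 1 else 0) / (2 ^ n - 1) : ℝ) : ℂ) *
        if l = i ∧ l = i then ρ k k else 0)) =
        if l = i then ((2 : ℂ) ^ n - 1)⁻¹ * (ρ.trace - ρ l l) else 0 := by
      intro l
      split_ifs with h1 h2 h2
      · have h3 : ∀ k, ((((1 - if k = l then 1 else 0) / (2 ^ n - 1) : ℝ) : ℂ) * ρ k k) =
            ((2 : ℂ) ^ n - 1)⁻¹ * (ρ k k - if k = l then ρ k k else 0) := by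
          intro k
          push_cast
          split_ifs <;> push_cast <;> ring
        simp_rw [h3, ← Finset.mul_sum, Finset.sum_sub_distrib]
        simp [Matrix.trace]
      · exact absurd h1.1 h2
      · exact absurd ⟨h2, h2⟩ h1
      · simp
    simp_rw [h]
    simp
  · have h : ∀ l : Bits n, ¬ (l = i ∧ l = j) := fun l hl => hij (hl.1.symm.trans hl.2)
    simp [h, hij]

lemma isChannel_measurePrepare {n : ℕ} (hn : n ≠ 0) : IsChannel (measurePrepare n) := by
  constructor
  · rw [measurePrepare_eq_sum_sandwich]
    refine IsCompletelyPositive.sum fun k _ => IsCompletelyPositive.sum fun l _ =>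
      (isCompletelyPositive_sandwich _).smul (div_nonneg ?_ ?_)
    · split_ifs <;> norm_num
    · exact sub_nonneg.mpr (one_le_pow₀ one_le_two)
  · intro ρ
    have h := two_pow_sub_one_ne_zero hn
    rw [measurePrepare_apply, Matrix.trace_smul, Matrix.trace_sub, Matrix.trace_smul,
      Matrix.trace_one, Matrix.trace_diagonal, smul_eq_mul, inv_mul_eq_iff_eq_mul₀ h]
    simp only [smul_eq_mul, Matrix.trace, Matrix.diag_apply, Fintype.card_pi, Fintype.card_fin,
      Finset.prod_const, Finset.card_univ]
    push_cast
    ring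

/-! ### Twirling the measure-and-prepare channel -/

/-- Dephasing in the basis of `V` is an average over the commuting set diagonalized by `V`. -/
lemma conj_diagonal_eq_sum {n : ℕ} {V : QOp n} (hV : V * Vᴴ = 1) {S : Set (QOp n)}
    (hcard : S.ncard = 2 ^ n - 1) {s : Bits n → ℤˣ}
    (hS : S = {P | ∃ a : Bits n, a ≠ 0 ∧ P = ((s a : ℤ) : ℂ) • (V * opZ a * Vᴴ)}) (ρ : QOp n) :
    (2 : ℂ) ^ n • (V * (Matrix.diagonal fun k => (Vᴴ * ρ * V) k k) * Vᴴ) =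
      ρ + ∑ᶠ P ∈ S, sandwich P P ρ := by
  let f : Bits n → QOp n := fun a => ((s a : ℤ) : ℂ) • (V * opZ a * Vᴴ)
  have himg : S = f '' ((Finset.univ.erase (0 : Bits n) : Finset (Bits n)) : Set (Bits n)) := by
    rw [hS]
    ext P
    simp [f, eq_comm]
  -- Injectivity comes from counting: `S` is the image of `2^n - 1` labels and has `2^n - 1`
  -- elements.
  have hinj : Set.InjOn f ((Finset.univ.erase (0 : Bits n) : Finset (Bits n)) : Set (Bits n)) := by
    rw [← Set.ncard_image_iff, ← himg, hcard, Set.ncard_coe_finset,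
      Finset.card_erase_of_mem (Finset.mem_univ _)]
    simp
  have hconj : ∀ a, sandwich (f a) (f a) ρ = V * (opZ a * (Vᴴ * ρ * V) * opZ a) * Vᴴ := by
    intro a
    have hs : ((s a : ℤ) : ℂ) * ((s a : ℤ) : ℂ) = 1 := by
      rcases Int.units_eq_one_or (s a) with h | h <;> simp [h]
    simp only [sandwich_apply, f, Matrix.smul_mul, Matrix.mul_smul, smul_smul, hs, one_smul]
    simp only [mul_assoc]
  have hzero : V * (opZ 0 * (Vᴴ * ρ * V) * opZ 0) * Vᴴ = ρ := by
    rw [opZ_zero, one_mul, mul_one, ← mul_assoc, ← mul_assoc, hV, one_mul, mul_assoc, hV, mul_one]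
  rw [himg, finsum_mem_image hinj, finsum_mem_coe_finset]
  simp only [hconj]
  have hsum := Finset.add_sum_erase Finset.univ
    (fun a => V * (opZ a * (Vᴴ * ρ * V) * opZ a) * Vᴴ) (Finset.mem_univ 0)
  rw [hzero] at hsum
  rw [hsum, ← Finset.sum_mul, ← Finset.mul_sum, sum_opZ_conj, Matrix.mul_smul, Matrix.smul_mul]

lemma sum_erase_pauli_conj {n : ℕ} (ρ : QOp n) :
    ∑ a ∈ Finset.univ.erase (0 : Bits n × Bits n), sandwich (pauli a) (pauli a) ρ =
      ((2 : ℂ) ^ n * ρ.trace) • (1 : QOp n) - ρ := by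
  rw [Finset.sum_erase_eq_sub (Finset.mem_univ _), sum_pauli_conj, pauli_zero, sandwich_apply,
    one_mul, mul_one]

lemma sum_finsum_partition {n : ℕ} {S : Fin (2 ^ n + 1) → Set (QOp n)}
    (hS : IsMaxCommutingPartition S) (ρ : QOp n) :
    ∑ j, ∑ᶠ P ∈ S j, sandwich P P ρ = ((2 : ℂ) ^ n * ρ.trace) • (1 : QOp n) - ρ := by
  have himg : nonIdPaulis n = pauli ''
      ((Finset.univ.erase (0 : Bits n × Bits n) : Finset (Bits n × Bits n)) :
        Set (Bits n × Bits n)) := by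
    ext P
    simp [nonIdPaulis, eq_comm]
  have hfin : (nonIdPaulis n).Finite := himg ▸ (Finset.finite_toSet _).image _
  rw [← finsum_eq_sum_of_fintype, ← finsum_mem_iUnion hS.disjoint
    (fun j => hfin.subset (hS.union ▸ Set.subset_iUnion S j)), hS.union, himg,
    finsum_mem_image pauli_injective.injOn, finsum_mem_coe_finset, sum_erase_pauli_conj]

/-- Summed over `j`, the bracket is `(2^n + 1) tr(ρ) I - 2^{-n} ((2^n + 1) ρ + 2^n tr(ρ) I - ρ) =
2^n tr(ρ) I - ρ`; the prefactors combine to `1 / (4^n - 1)`. -/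
lemma twirl_measurePrepare {n : ℕ} (hn : n ≠ 0)
    {V : Fin (2 ^ n + 1) → Matrix.unitaryGroup (Bits n) ℂ} (hV : IsDiagonalizingFamily V)
    (ρ : QOp n) :
    twirl (adjointEnsemble V) (measurePrepare n) ρ =
      ((2 : ℂ) ^ (2 * n) - 1)⁻¹ • (((2 : ℂ) ^ n * ρ.trace) • (1 : QOp n) - ρ) := by
  obtain ⟨S, s, hS, hSs⟩ := hV
  have hVV : ∀ j, (V j : QOp n) * (V j : QOp n)ᴴ = 1 := fun j => Unitary.coe_mul_star_self (V j)
  have h2n : (2 : ℂ) ^ n ≠ 0 := pow_ne_zero _ two_ne_zero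
  have hterm : ∀ j, (sandwich (V j : QOp n) ((V j : QOp n)ᴴ)) (measurePrepare n
      (sandwich ((V j : QOp n)ᴴ) (V j : QOp n) ρ)) = ((2 : ℂ) ^ n - 1)⁻¹ •
        (ρ.trace • (1 : QOp n) - ((2 : ℂ) ^ n)⁻¹ • (ρ + ∑ᶠ P ∈ S j, sandwich P P ρ)) := by
    intro j
    rw [← conj_diagonal_eq_sum (hVV j) (hS.card j) (hSs j), smul_smul, inv_mul_cancel₀ h2n,
      one_smul, measurePrepare_apply, sandwich_apply, sandwich_apply]
    have ht : ((V j : QOp n)ᴴ * (ρ * (V j : QOp n))).trace = ρ.trace := by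
      rw [Matrix.trace_mul_comm, mul_assoc, hVV, mul_one]
    rw [ht, Matrix.smul_mul, Matrix.mul_smul, Matrix.sub_mul, Matrix.mul_sub, Matrix.smul_mul,
      Matrix.mul_smul, one_mul, hVV]
    simp only [mul_assoc]
  have hsum : twirl (adjointEnsemble V) (measurePrepare n) ρ =
      ∑ j, ((2 : ℂ) ^ n + 1)⁻¹ • (((2 : ℂ) ^ n - 1)⁻¹ •
        (ρ.trace • (1 : QOp n) - ((2 : ℂ) ^ n)⁻¹ • (ρ + ∑ᶠ P ∈ S j, sandwich P P ρ))) := by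
    rw [twirl, LinearMap.sum_apply]
    refine Finset.sum_congr rfl fun j _ => ?_
    rw [← hterm j]
    simp only [adjointEnsemble, LinearMap.smul_apply, LinearMap.comp_apply, Unitary.coe_star,
      Matrix.star_eq_conjTranspose, Matrix.conjTranspose_conjTranspose]
    push_cast
    rfl
  rw [hsum, ← Finset.smul_sum, ← Finset.smul_sum, Finset.sum_sub_distrib,
    ← Finset.smul_sum, ← Finset.smul_sum, Finset.sum_add_distrib, sum_finsum_partition hS]
  simp only [Finset.sum_const, Finset.card_univ, Fintype.card_fin, ← Nat.cast_smul_eq_nsmul ℂ]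
  have h1 := two_pow_sub_one_ne_zero hn
  have h3 : (2 : ℂ) ^ n + 1 ≠ 0 := by
    have : (2 : ℝ) ^ n + 1 ≠ 0 := by positivity
    exact_mod_cast this
  have h4 : (2 : ℂ) ^ (2 * n) - 1 = (2 ^ n + 1) * (2 ^ n - 1) := by
    rw [mul_comm 2 n, pow_mul]; ring
  rw [h4, mul_inv, smul_smul]
  congr 1
  ext k l
  simp only [Matrix.sub_apply, Matrix.smul_apply, Matrix.add_apply, smul_eq_mul]
  push_cast
  field_simp
  ring

/-! ### Bounds on the entanglement fidelity -/

lemma entFidelity_nonneg {n : ℕ} {C : SuperOp n} (hC : IsChannel C) : 0 ≤ entFidelity C :=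
  (Complex.le_def.mp ((hC.1.posSemidef_ampliation
    (Matrix.posSemidef_vecMulVec_self_star (maxEntangled n))).dotProduct_mulVec_nonneg
      (maxEntangled n))).1

lemma depolarizing_apply {n : ℕ} (p : ℝ) (ρ : QOp n) :
    depolarizing n p ρ = (p : ℂ) • ρ + (((1 - p) / (2 ^ (2 * n) - 1) : ℝ) : ℂ) •
      (((2 : ℂ) ^ n * ρ.trace) • (1 : QOp n) - ρ) := by
  rw [← sum_erase_pauli_conj]
  simp [depolarizing, LinearMap.sum_apply]

lemma four_pow_sub_one_pos {n : ℕ} (hn : n ≠ 0) : (0 : ℝ) < 2 ^ (2 * n) - 1 :=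
  sub_pos.mpr (one_lt_pow₀ one_lt_two (by omega))

/-- A depolarizing map that is a channel has parameter at most one. -/
lemma le_one_of_isChannel_depolarizing {n : ℕ} (hn : n ≠ 0) {p : ℝ}
    (h : IsChannel (depolarizing n p)) : p ≤ 1 := by
  have : Nonempty (Fin n) := ⟨⟨0, Nat.pos_of_ne_zero hn⟩⟩
  obtain ⟨k, hk⟩ := exists_ne (0 : Bits n)
  have hρ : (basisProj (0 : Bits n)).PosSemidef := by
    have h1 : basisProj (0 : Bits n) = Matrix.diagonal (Pi.single 0 1) := by
      rw [basisProj, Matrix.diagonal_single]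
    rw [h1, Matrix.posSemidef_diagonal_iff]
    intro i
    by_cases hi : i = 0
    · subst hi; simp
    · simp [hi]
  -- With a trivial reference this is plain positivity. As `k ≠ 0`, the `k`-th diagonal entry of
  -- `D_p(|0⟩⟨0|)` has no contribution from `ρ` itself, and its sign is that of `1 - p`.
  have hpos := (h.1.posSemidef_ampliation (R := Unit)
    (hρ.submatrix Prod.snd)).diag_nonneg (i := ((), k))
  have hval : ampliation Unit (depolarizing n p)
      ((basisProj (0 : Bits n)).submatrix Prod.snd Prod.snd) ((), k) ((), k) =
        (((1 - p) / (2 ^ (2 * n) - 1) * 2 ^ n : ℝ) : ℂ) := by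
    change depolarizing n p (basisProj 0) k k = _
    rw [depolarizing_apply]
    simp [basisProj, hk.symm, Matrix.trace_single_eq_same]
  rw [hval] at hpos
  have hpos' : (0 : ℝ) ≤ (1 - p) / (2 ^ (2 * n) - 1) * 2 ^ n := by exact_mod_cast hpos
  have h2 := nonneg_of_mul_nonneg_left hpos' (by positivity)
  have h3 := (le_div_iff₀ (four_pow_sub_one_pos hn)).mp h2
  linarith

end ChannelQPD

end

/-! ### The quasiprobability decomposition and its overhead -/

theorem theorem1 (n : ℕ) (hn : 1 ≤ n) :
    (∃ V : Fin (2 ^ n + 1) → Matrix.unitaryGroup (ChannelQPD.Bits n) ℂ,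
      ChannelQPD.IsDiagonalizingFamily V) ∧
    ∀ (C : ChannelQPD.SuperOp n), ChannelQPD.IsChannel C → ChannelQPD.entFidelity C ≠ 0 →
    ∀ (K : ℕ) (E : ChannelQPD.UnitaryEnsemble n K),
      ChannelQPD.twirl E C = ChannelQPD.depolarizing n (ChannelQPD.entFidelity C) →
    ∀ (V : Fin (2 ^ n + 1) → Matrix.unitaryGroup (ChannelQPD.Bits n) ℂ),
      ChannelQPD.IsDiagonalizingFamily V →
      ChannelQPD.IsQPD (LinearMap.id : ChannelQPD.SuperOp n)
        ![1 / ChannelQPD.entFidelity C, -(1 / ChannelQPD.entFidelity C - 1)]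
        ![ChannelQPD.twirl E C,
          ChannelQPD.twirl (ChannelQPD.adjointEnsemble V) (ChannelQPD.measurePrepare n)] ∧
      ChannelQPD.samplingOverhead
        ![1 / ChannelQPD.entFidelity C, -(1 / ChannelQPD.entFidelity C - 1)] =
          2 / ChannelQPD.entFidelity C - 1 := by
  have hn' : n ≠ 0 := Nat.one_le_iff_ne_zero.mp hn
  refine ⟨ChannelQPD.exists_isDiagonalizingFamily hn', fun C hC hF K E hE V hV => ?_⟩
  have htwirl := ChannelQPD.isChannel_twirl E hC
  have hle : ChannelQPD.entFidelity C ≤ 1 :=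
    ChannelQPD.le_one_of_isChannel_depolarizing hn' (hE ▸ htwirl)
  have hpos : 0 < ChannelQPD.entFidelity C :=
    lt_of_le_of_ne (ChannelQPD.entFidelity_nonneg hC) hF.symm
  refine ⟨⟨?_, ?_, ?_⟩, ?_⟩
  · intro i
    fin_cases i
    · exact htwirl
    · exact ChannelQPD.isChannel_twirl _ (ChannelQPD.isChannel_measurePrepare hn')
  · simp [Fin.sum_univ_two]
  · refine LinearMap.ext fun ρ => ?_
    simp only [Fin.sum_univ_two, Matrix.cons_val_zero, Matrix.cons_val_one, LinearMap.add_apply,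
      LinearMap.smul_apply, LinearMap.id_apply]
    rw [hE, ChannelQPD.depolarizing_apply, ChannelQPD.twirl_measurePrepare hn' hV]
    have hF' : (ChannelQPD.entFidelity C : ℂ) ≠ 0 := by exact_mod_cast hF
    have hd : (2 : ℂ) ^ (2 * n) - 1 ≠ 0 := by
      exact_mod_cast (ChannelQPD.four_pow_sub_one_pos hn').ne'
    rw [smul_add, smul_smul, smul_smul, smul_smul, add_assoc, ← add_smul]
    have h1 : (((1 / ChannelQPD.entFidelity C : ℝ) : ℂ)) * (ChannelQPD.entFidelity C : ℂ) = 1 := by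
      push_cast
      field_simp
    rw [h1, one_smul, left_eq_add]
    -- The `D_0` parts cancel because `(1/F)(1 - F) = 1/F - 1`.
    convert zero_smul ℂ _ using 2
    push_cast
    field_simp
    ring
  · have h1 : 1 ≤ 1 / ChannelQPD.entFidelity C := (one_le_div hpos).mpr hle
    rw [ChannelQPD.samplingOverhead, Fin.sum_univ_two]
    change |1 / ChannelQPD.entFidelity C| + |-(1 / ChannelQPD.entFidelity C - 1)| = _
    rw [abs_neg, abs_of_nonneg (by linarith), abs_of_nonneg (by linarith)]
    ring
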